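/- Let $\mathsf{DFNL}^*$ be the distributive full nonassociative Lambek calculus admitting empty antecedents. Its formulas are built from propositional letters by $\cdot,\backslash,/,\wedge,\vee$. Its sequents are $\Gamma\Rightarrow A$, where $A$ is a formula and $\Gamma$ is a formula tree ($\Gamma::=A\mid\Gamma\circ\Delta$) or empty; the empty antecedent is neutral for $\circ$. Its axioms are $A\Rightarrow A$ and $A\wedge(B\vee C)\Rightarrow(A\wedge B)\vee(A\wedge C)$. Its rules are Cut (from $\Delta\Rightarrow A$ and $\Gamma[A]\Rightarrow B$ infer $\Gamma[\Delta]\Rightarrow B$) and the usual left and right rules of the nonassociative Lambek calculus for $\cdot,\backslash,/,\wedge,\vee$. Let $\mathsf{BDFNL}^*$ be its extension by the constants $\bot,\top$ with the axioms $\Gamma[\bot]\Rightarrow A$ and $\Gamma\Rightarrow\top$, where $\Gamma$ in the latter may be empty. Write $\Phi\vdash_S\Gamma\Rightarrow A$ if $\Gamma\Rightarrow A$ is derivable in $S$ with the sequents of $\Phi$ as additional axioms (not closed under substitution). Let $\Phi$ be a finite set of $\mathsf{BDFNL}^*$-sequents and $\Gamma\Rightarrow A$ a $\mathsf{BDFNL}^*$-sequent.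 Let $T$ be the set consisting of $\bot$, $\top$ and all subformulas of formulas occurring in $\Gamma\Rightarrow A$ or in $\Phi$. Let $p_\bot\neq p_\top$ be two propositional letters that do not occur in $\Gamma\Rightarrow A$ or in $\Phi$. Let $(\cdot)^\S$ be the translation that replaces $\bot$ by $p_\bot$ and $\top$ by $p_\top$ and leaves everything else unchanged (applied to every formula of a tree, of a sequent, or of a sequent of a set), and let $ec(T)=\{B^\S\mid B\in T\}$. Let $\Theta[ec(T)]$ be the set consisting of the sequents $$p_\bot\Rightarrow B,\quad B\circ p_\bot\Rightarrow p_\bot,\quad p_\bot\circ B\Rightarrow p_\bot,\quad B\Rightarrow p_\top,\quad B\circ p_\top\Rightarrow p_\top,\quad p_\top\circ B\Rightarrow p_\top\qquad(B\in ec(T))$$ and the sequent $\Rightarrow p_\top$. Then $\Theta[ec(T)]$ is finite, and $$\Phi\vdash_{\mathsf{BDFNL}^*}\Gamma\Rightarrow A\quad\text{if and only if}\quad\Phi^\S\cup\Theta[ec(T)]\vdash_{\mathsf{DFNL}^*}\Gamma^\S\Rightarrow A^\S .$$ -/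

import Mathlib

/-- Formulas of the language of BDFNL* (with the constants `⊥` and `⊤`) over a set `P` of
propositional letters.  `under A B` is `A \ B` and `over A B` is `A / B`. -/
inductive BFml (P : Type*) where
  | atom (p : P) : BFml P
  | bot : BFml P
  | top : BFml P
  | and (A B : BFml P) : BFml P
  | or (A B : BFml P) : BFml P
  | prod (A B : BFml P) : BFml P
  | under (A B : BFml P) : BFml P
  | over (A B : BFml P) : BFml P

/-- Formulas of the language of DFNL* (without `⊥` and `⊤`).
`under A B` is `A \ B` and `over A B` is `A / B`. -/
inductive DFml (P : Type*) where
  | atom (p : P) : DFml P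
  | and (A B : DFml P) : DFml P
  | or (A B : DFml P) : DFml P
  | prod (A B : DFml P) : DFml P
  | under (A B : DFml P) : DFml P
  | over (A B : DFml P) : DFml P

/-- Formula trees `Γ ::= A | Γ ∘ Δ`. -/
inductive FTree (F : Type*) where
  | leaf (A : F) : FTree F
  | node (X Y : FTree F) : FTree F

/-- Antecedents of sequents: a formula tree or (`none`) the empty antecedent. -/
abbrev Ant (F : Type*) := Option (FTree F)

/-- The antecedent consisting of a single formula. -/
def Ant.fml {F : Type*} (A : F) : Ant F := some (FTree.leaf A)

/-- `Γ ∘ Δ`; the empty antecedent is neutral. -/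
def Ant.comp {F : Type*} : Ant F → Ant F → Ant F
  | none, Y => Y
  | some X, none => some X
  | some X, some Y => some (FTree.node X Y)

/-- Formula trees `Γ[-]` with one hole. -/
inductive FCtx (F : Type*) where
  | hole : FCtx F
  | left (C : FCtx F) (Y : FTree F) : FCtx F
  | right (X : FTree F) (C : FCtx F) : FCtx F

/-- `Γ[Δ]`: fill the hole of `Γ[-]` with `Δ`, which may be empty. -/
def FCtx.fill {F : Type*} : FCtx F → Ant F → Ant F
  | FCtx.hole, D => D
  | FCtx.left C Y, D => Ant.comp (C.fill D) (some Y)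
  | FCtx.right X C, D => Ant.comp (some X) (C.fill D)

/-- Sequents `Γ ⇒ A`. -/
structure Sequent (F : Type*) where
  ant : Ant F
  suc : F

/-- Apply a map to every formula of a formula tree. -/
def FTree.map {F G : Type*} (f : F → G) : FTree F → FTree G
  | FTree.leaf A => FTree.leaf (f A)
  | FTree.node X Y => FTree.node (X.map f) (Y.map f)

/-- Apply a map to every formula of a sequent. -/
def Sequent.map {F G : Type*} (f : F → G) (s : Sequent F) : Sequent G :=
  ⟨Option.map (FTree.map f) s.ant, f s.suc⟩

/-- The set of formulas at the leaves of a formula tree. -/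
def FTree.fmls {F : Type*} : FTree F → Set F
  | FTree.leaf A => {A}
  | FTree.node X Y => X.fmls ∪ Y.fmls

/-- The set of formulas occurring in a sequent (as a leaf of the antecedent or as the succedent). -/
def Sequent.fmls {F : Type*} (s : Sequent F) : Set F :=
  {A | (∃ X, s.ant = some X ∧ A ∈ X.fmls) ∨ A = s.suc}

/-- `BDFNL Φ Γ A`: the sequent `Γ ⇒ A` is derivable from the set `Φ` of assumptions in BDFNL*.
Antecedents (`Γ` and `Δ` below) may be empty. -/
inductive BDFNL {P : Type*} (Φ : Set (Sequent (BFml P))) : Ant (BFml P) → BFml P → Prop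
  | assume (s : Sequent (BFml P)) (hs : s ∈ Φ) : BDFNL Φ s.ant s.suc
  | id (A : BFml P) : BDFNL Φ (Ant.fml A) A
  | distr (A B C : BFml P) :
      BDFNL Φ (Ant.fml (.and A (.or B C))) (.or (.and A B) (.and A C))
  | botL (Γ : FCtx (BFml P)) (A : BFml P) : BDFNL Φ (Γ.fill (Ant.fml .bot)) A
  | topR (Γ : Ant (BFml P)) : BDFNL Φ Γ .top
  | underL (Γ : FCtx (BFml P)) (Δ : Ant (BFml P)) (A B C : BFml P)
      (h₁ : BDFNL Φ Δ A) (h₂ : BDFNL Φ (Γ.fill (Ant.fml B)) C) :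
      BDFNL Φ (Γ.fill (Ant.comp Δ (Ant.fml (.under A B)))) C
  | underR (Γ : Ant (BFml P)) (A B : BFml P) (h : BDFNL Φ (Ant.comp (Ant.fml A) Γ) B) :
      BDFNL Φ Γ (.under A B)
  | overL (Γ : FCtx (BFml P)) (Δ : Ant (BFml P)) (A B C : BFml P)
      (h₁ : BDFNL Φ (Γ.fill (Ant.fml A)) C) (h₂ : BDFNL Φ Δ B) :
      BDFNL Φ (Γ.fill (Ant.comp (Ant.fml (.over A B)) Δ)) C
  | overR (Γ : Ant (BFml P)) (A B : BFml P) (h : BDFNL Φ (Ant.comp Γ (Ant.fml B)) A) :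
      BDFNL Φ Γ (.over A B)
  | prodL (Γ : FCtx (BFml P)) (A B C : BFml P)
      (h : BDFNL Φ (Γ.fill (Ant.comp (Ant.fml A) (Ant.fml B))) C) :
      BDFNL Φ (Γ.fill (Ant.fml (.prod A B))) C
  | prodR (Γ Δ : Ant (BFml P)) (A B : BFml P) (h₁ : BDFNL Φ Γ A) (h₂ : BDFNL Φ Δ B) :
      BDFNL Φ (Ant.comp Γ Δ) (.prod A B)
  | cut (Γ : FCtx (BFml P)) (Δ : Ant (BFml P)) (A B : BFml P)
      (h₁ : BDFNL Φ Δ A) (h₂ : BDFNL Φ (Γ.fill (Ant.fml A)) B) : BDFNL Φ (Γ.fill Δ) B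
  | andL₁ (Γ : FCtx (BFml P)) (A₁ A₂ B : BFml P) (h : BDFNL Φ (Γ.fill (Ant.fml A₁)) B) :
      BDFNL Φ (Γ.fill (Ant.fml (.and A₁ A₂))) B
  | andL₂ (Γ : FCtx (BFml P)) (A₁ A₂ B : BFml P) (h : BDFNL Φ (Γ.fill (Ant.fml A₂)) B) :
      BDFNL Φ (Γ.fill (Ant.fml (.and A₁ A₂))) B
  | andR (Γ : Ant (BFml P)) (A B : BFml P) (h₁ : BDFNL Φ Γ A) (h₂ : BDFNL Φ Γ B) :
      BDFNL Φ Γ (.and A B)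
  | orL (Γ : FCtx (BFml P)) (A₁ A₂ B : BFml P) (h₁ : BDFNL Φ (Γ.fill (Ant.fml A₁)) B)
      (h₂ : BDFNL Φ (Γ.fill (Ant.fml A₂)) B) : BDFNL Φ (Γ.fill (Ant.fml (.or A₁ A₂))) B
  | orR₁ (Γ : Ant (BFml P)) (A₁ A₂ : BFml P) (h : BDFNL Φ Γ A₁) : BDFNL Φ Γ (.or A₁ A₂)
  | orR₂ (Γ : Ant (BFml P)) (A₁ A₂ : BFml P) (h : BDFNL Φ Γ A₂) : BDFNL Φ Γ (.or A₁ A₂)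

/-- `DFNL Φ Γ A`: the sequent `Γ ⇒ A` is derivable from the set `Φ` of assumptions in DFNL*,
which has the same rules as BDFNL* except for the axioms for `⊥` and `⊤`. -/
inductive DFNL {P : Type*} (Φ : Set (Sequent (DFml P))) : Ant (DFml P) → DFml P → Prop
  | assume (s : Sequent (DFml P)) (hs : s ∈ Φ) : DFNL Φ s.ant s.suc
  | id (A : DFml P) : DFNL Φ (Ant.fml A) A
  | distr (A B C : DFml P) :
      DFNL Φ (Ant.fml (.and A (.or B C))) (.or (.and A B) (.and A C))
  | underL (Γ : FCtx (DFml P)) (Δ : Ant (DFml P)) (A B C : DFml P)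
      (h₁ : DFNL Φ Δ A) (h₂ : DFNL Φ (Γ.fill (Ant.fml B)) C) :
      DFNL Φ (Γ.fill (Ant.comp Δ (Ant.fml (.under A B)))) C
  | underR (Γ : Ant (DFml P)) (A B : DFml P) (h : DFNL Φ (Ant.comp (Ant.fml A) Γ) B) :
      DFNL Φ Γ (.under A B)
  | overL (Γ : FCtx (DFml P)) (Δ : Ant (DFml P)) (A B C : DFml P)
      (h₁ : DFNL Φ (Γ.fill (Ant.fml A)) C) (h₂ : DFNL Φ Δ B) :
      DFNL Φ (Γ.fill (Ant.comp (Ant.fml (.over A B)) Δ)) C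
  | overR (Γ : Ant (DFml P)) (A B : DFml P) (h : DFNL Φ (Ant.comp Γ (Ant.fml B)) A) :
      DFNL Φ Γ (.over A B)
  | prodL (Γ : FCtx (DFml P)) (A B C : DFml P)
      (h : DFNL Φ (Γ.fill (Ant.comp (Ant.fml A) (Ant.fml B))) C) :
      DFNL Φ (Γ.fill (Ant.fml (.prod A B))) C
  | prodR (Γ Δ : Ant (DFml P)) (A B : DFml P) (h₁ : DFNL Φ Γ A) (h₂ : DFNL Φ Δ B) :
      DFNL Φ (Ant.comp Γ Δ) (.prod A B)
  | cut (Γ : FCtx (DFml P)) (Δ : Ant (DFml P)) (A B : DFml P)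
      (h₁ : DFNL Φ Δ A) (h₂ : DFNL Φ (Γ.fill (Ant.fml A)) B) : DFNL Φ (Γ.fill Δ) B
  | andL₁ (Γ : FCtx (DFml P)) (A₁ A₂ B : DFml P) (h : DFNL Φ (Γ.fill (Ant.fml A₁)) B) :
      DFNL Φ (Γ.fill (Ant.fml (.and A₁ A₂))) B
  | andL₂ (Γ : FCtx (DFml P)) (A₁ A₂ B : DFml P) (h : DFNL Φ (Γ.fill (Ant.fml A₂)) B) :
      DFNL Φ (Γ.fill (Ant.fml (.and A₁ A₂))) B
  | andR (Γ : Ant (DFml P)) (A B : DFml P) (h₁ : DFNL Φ Γ A) (h₂ : DFNL Φ Γ B) :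
      DFNL Φ Γ (.and A B)
  | orL (Γ : FCtx (DFml P)) (A₁ A₂ B : DFml P) (h₁ : DFNL Φ (Γ.fill (Ant.fml A₁)) B)
      (h₂ : DFNL Φ (Γ.fill (Ant.fml A₂)) B) : DFNL Φ (Γ.fill (Ant.fml (.or A₁ A₂))) B
  | orR₁ (Γ : Ant (DFml P)) (A₁ A₂ : DFml P) (h : DFNL Φ Γ A₁) : DFNL Φ Γ (.or A₁ A₂)
  | orR₂ (Γ : Ant (DFml P)) (A₁ A₂ : DFml P) (h : DFNL Φ Γ A₂) : DFNL Φ Γ (.or A₁ A₂)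

/-- The set of subformulas of a formula. -/
def BFml.sub {P : Type*} : BFml P → Set (BFml P)
  | .atom p => {.atom p}
  | .bot => {.bot}
  | .top => {.top}
  | .and A B => {.and A B} ∪ A.sub ∪ B.sub
  | .or A B => {.or A B} ∪ A.sub ∪ B.sub
  | .prod A B => {.prod A B} ∪ A.sub ∪ B.sub
  | .under A B => {.under A B} ∪ A.sub ∪ B.sub
  | .over A B => {.over A B} ∪ A.sub ∪ B.sub

/-- The set `T`: all subformulas of formulas occurring in the sequent `s` or in a sequent of `Φ`,
together with `⊥` and `⊤`. -/
def subT {P : Type*} (Φ : Set (Sequent (BFml P))) (s : Sequent (BFml P)) : Set (BFml P) :=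
  {B | ∃ t, (t = s ∨ t ∈ Φ) ∧ ∃ A ∈ t.fmls, B ∈ A.sub} ∪ {.bot, .top}

/-- The translation `§`: replace `⊥` by the letter `pb` and `⊤` by the letter `pt`. -/
def BFml.sec {P : Type*} (pb pt : P) : BFml P → DFml P
  | .atom p => .atom p
  | .bot => .atom pb
  | .top => .atom pt
  | .and A B => .and (A.sec pb pt) (B.sec pb pt)
  | .or A B => .or (A.sec pb pt) (B.sec pb pt)
  | .prod A B => .prod (A.sec pb pt) (B.sec pb pt)
  | .under A B => .under (A.sec pb pt) (B.sec pb pt)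
  | .over A B => .over (A.sec pb pt) (B.sec pb pt)

/-- `ec(T)`: replace `⊥` and `⊤` by the letters `pb` and `pt` in all formulas of `T`. -/
def ec {P : Type*} (pb pt : P) (T : Set (BFml P)) : Set (DFml P) :=
  BFml.sec pb pt '' T

/-- `Θ[T]`: the sequents `pb ⇒ A`, `A ∘ pb ⇒ pb`, `pb ∘ A ⇒ pb`, `A ⇒ pt`, `A ∘ pt ⇒ pt`,
`pt ∘ A ⇒ pt` for `A ∈ T`, and the sequent `⇒ pt` with empty antecedent, which is the
counterpart of the instance `⇒ ⊤` of the axiom `Γ ⇒ ⊤`. -/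
def Theta {P : Type*} (pb pt : P) (T : Set (DFml P)) : Set (Sequent (DFml P)) :=
  {s | (∃ A ∈ T,
      s = ⟨Ant.fml (.atom pb), A⟩ ∨
      s = ⟨Ant.comp (Ant.fml A) (Ant.fml (.atom pb)), .atom pb⟩ ∨
      s = ⟨Ant.comp (Ant.fml (.atom pb)) (Ant.fml A), .atom pb⟩ ∨
      s = ⟨Ant.fml A, .atom pt⟩ ∨
      s = ⟨Ant.comp (Ant.fml A) (Ant.fml (.atom pt)), .atom pt⟩ ∨
      s = ⟨Ant.comp (Ant.fml (.atom pt)) (Ant.fml A), .atom pt⟩) ∨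
    s = ⟨none, .atom pt⟩}

/-! From right to left, substituting `⊥` and `⊤` back for the two letters turns a DFNL* derivation
into a BDFNL* derivation: every sequent of `Theta` becomes an instance of a `⊥` or `⊤` axiom, and
freshness of the letters makes the substitution invert `§` on the given sequents (`BDFNL.of_DFNL`,
`BDFNL.unsec_theta`, `BFml.unsec_sec`).

From left to right, a derivation may pass through formulas outside `T`, for which no bounds are
assumed, so it cannot simply be translated line by line. The argument is semantic. BDFNL* is sound
for ternary frames with unit points in which `⊥` is the empty set and `⊤` the whole set
(`UnitalFrame.soundness`). The countermodel has as points the prime theories of DFNL* over the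
translated assumptions that contain `pt` and omit `pb`; this choice makes the letters behave at
every point like the constants. The truth lemma `mem_sem_iff` holds only for formulas all of whose
subformulas lie between `pb` and `pt`, which `Theta` guarantees on `T`. An underivable translation
is then refuted at some point of a frame where the assumptions hold.

Existence of enough points comes from the prime ideal theorem for distributive lattices
(`IsTheory.exists_prime`) and the extension lemmas `PrimeTheory.exists_left` and
`PrimeTheory.exists_right`. -/

/-! ### Kripke frames with a ternary relation and unit points -/

/-- Ternary relational frames with a set of unit points. -/
structure UnitalFrame (W : Type*) [Preorder W] where
  R : W → W → W → Prop
  E : Set W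
  R_mono : ∀ {x x' y y' z z'}, R x y z → x' ≤ x → y' ≤ y → z ≤ z' → R x' y' z'
  E_upper : IsUpperSet E
  le_of_left : ∀ {e x z}, e ∈ E → R e x z → x ≤ z
  le_of_right : ∀ {e x z}, e ∈ E → R x e z → x ≤ z
  exists_left : ∀ x, ∃ e ∈ E, R e x x
  exists_right : ∀ x, ∃ e ∈ E, R x e x

namespace UnitalFrame

variable {P W : Type*} [Preorder W] (F : UnitalFrame W) (v : P → Set W)

/-- The complex product of two sets of points. -/
def mul (U V : Set W) : Set W := {z | ∃ x ∈ U, ∃ y ∈ V, F.R x y z}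

/-- The truth set of a formula. -/
def sem : BFml P → Set W
  | .atom p => v p
  | .bot => ∅
  | .top => Set.univ
  | .and A B => sem A ∩ sem B
  | .or A B => sem A ∪ sem B
  | .prod A B => F.mul (sem A) (sem B)
  | .under A B => {y | ∀ x ∈ sem A, ∀ z, F.R x y z → z ∈ sem B}
  | .over A B => {x | ∀ y ∈ sem B, ∀ z, F.R x y z → z ∈ sem A}

/-- The truth set of a formula tree. -/
def treeSem : FTree (BFml P) → Set W
  | .leaf A => F.sem v A
  | .node X Y => F.mul (treeSem X) (treeSem Y)

/-- The truth set of an antecedent. -/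
def antSem : Ant (BFml P) → Set W
  | none => F.E
  | some X => F.treeSem v X

/-- The relation between points induced by a context. -/
def ctxRel : FCtx (BFml P) → W → W → Prop
  | .hole, u, z => u ≤ z
  | .left C Y, u, z => ∃ x, ctxRel C u x ∧ ∃ y ∈ F.treeSem v Y, F.R x y z
  | .right X C, u, z => ∃ x ∈ F.treeSem v X, ∃ y, ctxRel C u y ∧ F.R x y z

variable {F v}

lemma mul_upper (U V : Set W) : IsUpperSet (F.mul U V) := by
  rintro z z' hz ⟨x, hx, y, hy, h⟩
  exact ⟨x, hx, y, hy, F.R_mono h le_rfl le_rfl hz⟩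

lemma mul_mono {U U' V V' : Set W} (hU : U ⊆ U') (hV : V ⊆ V') : F.mul U V ⊆ F.mul U' V' := by
  rintro z ⟨x, hx, y, hy, h⟩
  exact ⟨x, hU hx, y, hV hy, h⟩

/-- Together with `unit_mul`, this is what makes the empty antecedent neutral in the semantics. -/
lemma mul_unit {U : Set W} (hU : IsUpperSet U) : F.mul U F.E = U := by
  ext z
  constructor
  · rintro ⟨x, hx, e, he, h⟩
    exact hU (F.le_of_right he h) hx
  · intro hz
    obtain ⟨e, he, h⟩ := F.exists_right z
    exact ⟨z, hz, e, he, h⟩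

lemma unit_mul {U : Set W} (hU : IsUpperSet U) : F.mul F.E U = U := by
  ext z
  constructor
  · rintro ⟨e, he, x, hx, h⟩
    exact hU (F.le_of_left he h) hx
  · intro hz
    obtain ⟨e, he, h⟩ := F.exists_left z
    exact ⟨e, he, z, hz, h⟩

lemma sem_upper (hv : ∀ p, IsUpperSet (v p)) (A : BFml P) : IsUpperSet (F.sem v A) := by
  induction A with
  | atom p => exact hv p
  | bot => exact isUpperSet_empty
  | top => exact isUpperSet_univ
  | and A B hA hB => exact hA.inter hB
  | or A B hA hB => exact hA.union hB
  | prod A B => exact mul_upper _ _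
  | under A B =>
    intro y y' hy h x hx z hR
    exact h x hx z (F.R_mono hR le_rfl hy le_rfl)
  | _ A B =>
    intro y y' hy h x hx z hR
    exact h x hx z (F.R_mono hR hy le_rfl le_rfl)

lemma antSem_upper (hv : ∀ p, IsUpperSet (v p)) (Γ : Ant (BFml P)) :
    IsUpperSet (F.antSem v Γ) := by
  match Γ with
  | none => exact F.E_upper
  | some (.leaf A) => exact sem_upper hv A
  | some (.node X Y) => exact mul_upper _ _

lemma antSem_comp (hv : ∀ p, IsUpperSet (v p)) (Γ Δ : Ant (BFml P)) :
    F.antSem v (Γ.comp Δ) = F.mul (F.antSem v Γ) (F.antSem v Δ) := by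
  match Γ, Δ with
  | none, Δ => exact (unit_mul (antSem_upper hv Δ)).symm
  | some X, none => exact (mul_unit (antSem_upper hv (some X))).symm
  | some X, some Y => rfl

/-- Since a context acts as a relation on points, filling it is monotone and preserves unions and
the empty set; the rules `orL` and `botL` are sound for this reason. -/
lemma mem_antSem_fill (hv : ∀ p, IsUpperSet (v p)) (C : FCtx (BFml P)) (Δ : Ant (BFml P)) (z : W) :
    z ∈ F.antSem v (C.fill Δ) ↔ ∃ u ∈ F.antSem v Δ, F.ctxRel v C u z := by
  induction C generalizing z with
  | hole => exact ⟨fun h => ⟨z, h, le_rfl⟩, fun ⟨u, hu, h⟩ => antSem_upper hv Δ h hu⟩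
  | left C Y ih =>
    rw [FCtx.fill, antSem_comp hv]
    constructor
    · rintro ⟨x, hx, y, hy, h⟩
      obtain ⟨u, hu, hux⟩ := (ih x).1 hx
      exact ⟨u, hu, x, hux, y, hy, h⟩
    · rintro ⟨u, hu, x, hux, y, hy, h⟩
      exact ⟨x, (ih x).2 ⟨u, hu, hux⟩, y, hy, h⟩
  | right X C ih =>
    rw [FCtx.fill, antSem_comp hv]
    constructor
    · rintro ⟨x, hx, y, hy, h⟩
      obtain ⟨u, hu, huy⟩ := (ih y).1 hy
      exact ⟨u, hu, x, hx, y, huy, h⟩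
    · rintro ⟨u, hu, x, hx, y, huy, h⟩
      exact ⟨x, hx, y, (ih y).2 ⟨u, hu, huy⟩, h⟩

lemma antSem_fill_mono (hv : ∀ p, IsUpperSet (v p)) (C : FCtx (BFml P)) {Δ Δ' : Ant (BFml P)}
    (h : F.antSem v Δ ⊆ F.antSem v Δ') : F.antSem v (C.fill Δ) ⊆ F.antSem v (C.fill Δ') := by
  intro z hz
  obtain ⟨u, hu, hz⟩ := (mem_antSem_fill hv C Δ z).1 hz
  exact (mem_antSem_fill hv C Δ' z).2 ⟨u, h hu, hz⟩

/-- Sequents derivable in BDFNL* hold in every frame in which the assumptions hold. -/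
theorem soundness (hv : ∀ p, IsUpperSet (v p)) {Φ : Set (Sequent (BFml P))}
    (hΦ : ∀ s ∈ Φ, F.antSem v s.ant ⊆ F.sem v s.suc) {Γ : Ant (BFml P)} {A : BFml P}
    (h : BDFNL Φ Γ A) : F.antSem v Γ ⊆ F.sem v A := by
  induction h with
  | assume s hs => exact hΦ s hs
  | id A => exact subset_rfl
  | distr A B C => exact (Set.inter_union_distrib_left _ _ _).subset
  | botL Γ A =>
    intro z hz
    obtain ⟨u, hu, -⟩ := (mem_antSem_fill hv Γ _ z).1 hz
    exact absurd hu (Set.notMem_empty u)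
  | topR Γ => exact Set.subset_univ _
  | underL Γ Δ A B C _ _ ih₁ ih₂ =>
    refine (antSem_fill_mono hv Γ ?_).trans ih₂
    rw [antSem_comp hv]
    rintro z ⟨x, hx, y, hy, h⟩
    exact hy x (ih₁ hx) z h
  | underR Γ A B _ ih =>
    intro y hy x hx z h
    rw [antSem_comp hv] at ih
    exact ih ⟨x, hx, y, hy, h⟩
  | overL Γ Δ A B C _ _ ih₁ ih₂ =>
    refine (antSem_fill_mono hv Γ ?_).trans ih₁
    rw [antSem_comp hv]
    rintro z ⟨x, hx, y, hy, h⟩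
    exact hx y (ih₂ hy) z h
  | overR Γ A B _ ih =>
    intro x hx y hy z h
    rw [antSem_comp hv] at ih
    exact ih ⟨x, hx, y, hy, h⟩
  | prodL Γ A B C _ ih => exact (antSem_fill_mono hv Γ (Δ := Ant.fml (.prod A B))
      (Δ' := Ant.comp (Ant.fml A) (Ant.fml B)) (Set.Subset.refl (F.mul _ _))).trans ih
  | prodR Γ Δ A B _ _ ih₁ ih₂ =>
    rw [antSem_comp hv]
    exact mul_mono ih₁ ih₂
  | cut Γ Δ A B _ _ ih₁ ih₂ => exact (antSem_fill_mono hv Γ ih₁).trans ih₂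
  | andL₁ Γ A₁ A₂ B _ ih => exact (antSem_fill_mono hv Γ Set.inter_subset_left).trans ih
  | andL₂ Γ A₁ A₂ B _ ih => exact (antSem_fill_mono hv Γ Set.inter_subset_right).trans ih
  | andR Γ A B _ _ ih₁ ih₂ => exact Set.subset_inter ih₁ ih₂
  | orL Γ A₁ A₂ B _ _ ih₁ ih₂ =>
    intro z hz
    obtain ⟨u, hu | hu, hz⟩ := (mem_antSem_fill hv Γ _ z).1 hz
    · exact ih₁ ((mem_antSem_fill hv Γ _ z).2 ⟨u, hu, hz⟩)
    · exact ih₂ ((mem_antSem_fill hv Γ _ z).2 ⟨u, hu, hz⟩)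
  | orR₁ Γ A₁ A₂ _ ih => exact ih.trans Set.subset_union_left
  | orR₂ Γ A₁ A₂ _ ih => exact ih.trans Set.subset_union_right

end UnitalFrame

/-! ### The Lindenbaum preorder of DFNL* -/

namespace DFNL

variable {P : Type*} {Ψ : Set (Sequent (DFml P))} {Γ : Ant (DFml P)}
  {A A' B B' C D : DFml P}

lemma trans (h : DFNL Ψ Γ A) (h' : DFNL Ψ (Ant.fml A) B) : DFNL Ψ Γ B :=
  cut .hole Γ A B h h'

lemma and_left (A B : DFml P) : DFNL Ψ (Ant.fml (A.and B)) A := andL₁ .hole A B A (id A)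

lemma and_right (A B : DFml P) : DFNL Ψ (Ant.fml (A.and B)) B := andL₂ .hole A B B (id B)

lemma or_le (h : DFNL Ψ (Ant.fml A) C) (h' : DFNL Ψ (Ant.fml B) C) :
    DFNL Ψ (Ant.fml (A.or B)) C := orL .hole A B C h h'

lemma le_prod (A B : DFml P) : DFNL Ψ (Ant.comp (Ant.fml A) (Ant.fml B)) (A.prod B) :=
  prodR _ _ A B (id A) (id B)

lemma prod_le (h : DFNL Ψ (Ant.comp (Ant.fml A) (Ant.fml B)) C) :
    DFNL Ψ (Ant.fml (A.prod B)) C := prodL .hole A B C h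

lemma prod_mono (h : DFNL Ψ (Ant.fml A) A') (h' : DFNL Ψ (Ant.fml B) B') :
    DFNL Ψ (Ant.fml (A.prod B)) (A'.prod B') := prod_le (prodR _ _ _ _ h h')

lemma prod_under_le (A B : DFml P) : DFNL Ψ (Ant.fml (A.prod (A.under B))) B :=
  prod_le (underL .hole (Ant.fml A) A B B (id A) (id B))

lemma over_prod_le (A B : DFml P) : DFNL Ψ (Ant.fml ((A.over B).prod B)) A :=
  prod_le (overL .hole (Ant.fml B) A B A (id A) (id B))

lemma le_under (h : DFNL Ψ (Ant.fml (A.prod C)) B) : DFNL Ψ (Ant.fml C) (A.under B) :=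
  underR _ A B ((le_prod A C).trans h)

lemma le_over (h : DFNL Ψ (Ant.fml (C.prod B)) A) : DFNL Ψ (Ant.fml C) (A.over B) :=
  overR _ A B ((le_prod C B).trans h)

/-- By residuation, both disjuncts lie below `D.over C`. -/
lemma or_prod_le (h : DFNL Ψ (Ant.fml (A.prod C)) D) (h' : DFNL Ψ (Ant.fml (B.prod C)) D) :
    DFNL Ψ (Ant.fml ((A.or B).prod C)) D :=
  (prod_mono (or_le (le_over h) (le_over h')) (id C)).trans (over_prod_le D C)

lemma prod_or_le (h : DFNL Ψ (Ant.fml (C.prod A)) D) (h' : DFNL Ψ (Ant.fml (C.prod B)) D) :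
    DFNL Ψ (Ant.fml (C.prod (A.or B))) D :=
  (prod_mono (id C) (or_le (le_under h) (le_under h'))).trans (prod_under_le C D)

/-- Cutting a theorem fills a hole with the empty antecedent, which erases that place of the tree.
-/
lemma le_of_theorem_prod (hA : DFNL Ψ none A) (h : DFNL Ψ (Ant.fml (A.prod C)) D) :
    DFNL Ψ (Ant.fml C) D :=
  cut (.left .hole (.leaf C)) none A D hA ((le_prod A C).trans h)

lemma le_of_prod_theorem (hA : DFNL Ψ none A) (h : DFNL Ψ (Ant.fml (C.prod A)) D) :
    DFNL Ψ (Ant.fml C) D :=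
  cut (.right (.leaf C) .hole) none A D hA ((le_prod C A).trans h)

variable (Ψ)

/-- Interderivability of formulas. -/
abbrev setoid : Setoid (DFml P) where
  r A B := DFNL Ψ (Ant.fml A) B ∧ DFNL Ψ (Ant.fml B) A
  iseqv := ⟨fun A => ⟨id A, id A⟩, fun h => ⟨h.2, h.1⟩,
    fun h h' => ⟨h.1.trans h'.1, h'.2.trans h.2⟩⟩

/-- The Lindenbaum lattice. -/
abbrev Lindenbaum : Type _ := Quotient (setoid Ψ)

instance : Lattice (Lindenbaum Ψ) where
  le := Quotient.lift₂ (fun A B => DFNL Ψ (Ant.fml A) B) (by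
    rintro A B A' B' hA hB
    exact propext ⟨fun h => (hA.2.trans h).trans hB.1, fun h => (hA.1.trans h).trans hB.2⟩)
  le_refl := by rintro ⟨A⟩; exact id A
  le_trans := by rintro ⟨A⟩ ⟨B⟩ ⟨C⟩ h h'; exact trans h h'
  le_antisymm := by rintro ⟨A⟩ ⟨B⟩ h h'; exact Quotient.sound ⟨h, h'⟩
  sup := Quotient.map₂ DFml.or (by
    rintro A A' hA B B' hB
    exact ⟨or_le (orR₁ _ _ _ hA.1) (orR₂ _ _ _ hB.1),
      or_le (orR₁ _ _ _ hA.2) (orR₂ _ _ _ hB.2)⟩)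
  inf := Quotient.map₂ DFml.and (by
    rintro A A' hA B B' hB
    exact ⟨andR _ _ _ ((and_left _ _).trans hA.1) ((and_right _ _).trans hB.1),
      andR _ _ _ ((and_left _ _).trans hA.2) ((and_right _ _).trans hB.2)⟩)
  le_sup_left := by rintro ⟨A⟩ ⟨B⟩; exact orR₁ _ _ _ (id A)
  le_sup_right := by rintro ⟨A⟩ ⟨B⟩; exact orR₂ _ _ _ (id B)
  sup_le := by rintro ⟨A⟩ ⟨B⟩ ⟨C⟩ h h'; exact or_le h h'
  inf_le_left := by rintro ⟨A⟩ ⟨B⟩; exact and_left A B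
  inf_le_right := by rintro ⟨A⟩ ⟨B⟩; exact and_right A B
  le_inf := by rintro ⟨A⟩ ⟨B⟩ ⟨C⟩ h h'; exact andR _ _ _ h h'

/-- The distributivity axiom enters the construction here; the prime ideal theorem depends on it. -/
instance : DistribLattice (Lindenbaum Ψ) :=
  DistribLattice.ofInfSupLe (by rintro ⟨A⟩ ⟨B⟩ ⟨C⟩; exact distr A B C)

/-- The class of a formula in the Lindenbaum lattice. -/
abbrev mk (A : DFml P) : Lindenbaum Ψ := Quotient.mk (setoid Ψ) A

end DFNL

/-! ### Theories and prime theories -/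

section Canonical

variable {P : Type*} (Ψ : Set (Sequent (DFml P))) (b t : DFml P)

/-- The formulas `b` and `t` behave like bounds with respect to each other. -/
structure BoundPair : Prop where
  bot_top : DFNL Ψ (Ant.fml (b.prod t)) b
  top_bot : DFNL Ψ (Ant.fml (t.prod b)) b
  top_top : DFNL Ψ (Ant.fml (t.prod t)) t
  top : DFNL Ψ none t

/-- Sets of formulas containing `t` and closed under derivability and conjunction. -/
structure IsTheory (S : Set (DFml P)) : Prop where
  top_mem : t ∈ S
  up : ∀ {A B}, A ∈ S → DFNL Ψ (Ant.fml A) B → B ∈ S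
  and_mem : ∀ {A B}, A ∈ S → B ∈ S → A.and B ∈ S

/-- Prime theories containing `t` and not containing `b`. -/
structure PrimeTheory where
  carrier : Set (DFml P)
  isTheory : IsTheory Ψ t carrier
  prime : ∀ {A B}, A.or B ∈ carrier → A ∈ carrier ∨ B ∈ carrier
  bot_notMem : b ∉ carrier

variable {Ψ b t}

instance : Preorder (PrimeTheory Ψ b t) := Preorder.lift PrimeTheory.carrier

lemma isTheory_principal {A : DFml P} (hA : DFNL Ψ (Ant.fml A) t) :
    IsTheory Ψ t {B | DFNL Ψ (Ant.fml A) B} where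
  top_mem := hA
  up h h' := h.trans h'
  and_mem h h' := DFNL.andR _ _ _ h h'

lemma isTheory_theorems (h : DFNL Ψ none t) : IsTheory Ψ t {B | DFNL Ψ none B} where
  top_mem := h
  up h h' := h.trans h'
  and_mem h h' := DFNL.andR _ _ _ h h'

/-- A theory can be separated from a disjoint ideal by a prime theory. -/
lemma IsTheory.exists_prime {S I : Set (DFml P)} (hS : IsTheory Ψ t S) (hb : b ∈ I)
    (hdown : ∀ {A B}, B ∈ I → DFNL Ψ (Ant.fml A) B → A ∈ I)
    (hor : ∀ {A B}, A ∈ I → B ∈ I → A.or B ∈ I) (hd : ∀ A ∈ S, A ∉ I) :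
    ∃ x : PrimeTheory Ψ b t, S ⊆ x.carrier ∧ ∀ A ∈ I, A ∉ x.carrier := by
  have hF : Order.IsPFilter (DFNL.mk Ψ '' S) := by
    refine Order.IsPFilter.of_def ⟨_, t, hS.top_mem, rfl⟩ ?_ ?_
    · rintro _ ⟨A, hA, rfl⟩ _ ⟨B, hB, rfl⟩
      exact ⟨_, ⟨_, hS.and_mem hA hB, rfl⟩, DFNL.and_left A B, DFNL.and_right A B⟩
    · rintro _ ⟨B⟩ h ⟨A, hA, rfl⟩
      exact ⟨B, hS.up hA h, rfl⟩
  have hI : Order.IsIdeal (DFNL.mk Ψ '' I) := by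
    refine ⟨?_, ⟨_, b, hb, rfl⟩, ?_⟩
    · rintro _ ⟨B⟩ h ⟨A, hA, rfl⟩
      exact ⟨B, hdown hA h, rfl⟩
    · rintro _ ⟨A, hA, rfl⟩ _ ⟨B, hB, rfl⟩
      exact ⟨_, ⟨_, hor hA hB, rfl⟩, DFNL.orR₁ _ _ _ (.id A), DFNL.orR₂ _ _ _ (.id B)⟩
  have hdisj : Disjoint (hF.toPFilter : Set (DFNL.Lindenbaum Ψ))
      (hI.toIdeal : Set (DFNL.Lindenbaum Ψ)) := by
    refine Set.disjoint_left.2 ?_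
    rintro _ ⟨A, hA, rfl⟩ ⟨B, hB, h⟩
    exact hd A hA (hdown hB (Quotient.exact h).2)
  -- The prime theory is the complement of the prime ideal `J`, pulled back to formulas.
  obtain ⟨J, hJ, hIJ, hFJ⟩ := DistribLattice.prime_ideal_of_disjoint_filter_ideal hdisj
  have hmem : ∀ {A}, A ∈ S → DFNL.mk Ψ A ∉ J := fun hA hAJ =>
    Set.disjoint_left.1 hFJ ⟨_, hA, rfl⟩ hAJ
  have hbJ : ∀ {A}, A ∈ I → DFNL.mk Ψ A ∈ J := fun hA => hIJ ⟨_, hA, rfl⟩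
  refine ⟨⟨{A | DFNL.mk Ψ A ∉ J}, ⟨hmem hS.top_mem, ?_, ?_⟩, ?_, fun h => h (hbJ hb)⟩,
    fun A hA => hmem hA, fun A hA h => h (hbJ hA)⟩
  · exact fun {A B} hA h hB => hA (J.lower (show DFNL.mk Ψ A ≤ DFNL.mk Ψ B from h) hB)
  · exact fun {A B} hA hB h => (hJ.mem_or_mem (x := DFNL.mk Ψ A) (y := DFNL.mk Ψ B) h).elim hA hB
  · intro A B h
    by_contra hAB
    push Not at hAB
    simp only [Set.mem_ofPred_eq, not_not] at hAB
    exact h (Order.Ideal.sup_mem hAB.1 hAB.2)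

/-- A theory omitting a formula above `b` extends to a prime theory omitting it. -/
lemma IsTheory.exists_omitting {S : Set (DFml P)} (hS : IsTheory Ψ t S) {B : DFml P}
    (hB : DFNL Ψ (Ant.fml b) B) (h : B ∉ S) :
    ∃ x : PrimeTheory Ψ b t, S ⊆ x.carrier ∧ B ∉ x.carrier := by
  obtain ⟨x, hx, hx'⟩ := hS.exists_prime (b := b) (I := {A | DFNL Ψ (Ant.fml A) B}) hB
    (fun h h' => h'.trans h) DFNL.or_le (fun A hA h' => h (hS.up hA h'))
  exact ⟨x, hx, hx' B (.id B)⟩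

/-! ### The canonical frame: extension lemmas and membership of compound formulas -/

namespace PrimeTheory

variable (H : BoundPair Ψ b t)
include H

/-- The formulas `A` with `A.prod B` outside `z` for some `B` in `G` form an ideal: two witnesses
are combined by conjunction, using that `z` is prime. The ideal contains `b` with witness `t`,
because `b.prod t` lies below `b`, which `z` omits. A prime theory above `S` avoiding this ideal is
as required. -/
lemma exists_left {S G : Set (DFml P)} (hS : IsTheory Ψ t S) (hG : IsTheory Ψ t G)
    (z : PrimeTheory Ψ b t) (h : ∀ A ∈ S, ∀ B ∈ G, A.prod B ∈ z.carrier) :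
    ∃ x : PrimeTheory Ψ b t, S ⊆ x.carrier ∧ ∀ A ∈ x.carrier, ∀ B ∈ G, A.prod B ∈ z.carrier := by
  obtain ⟨x, hSx, hx⟩ := hS.exists_prime (b := b) (I := {A | ∃ B ∈ G, A.prod B ∉ z.carrier})
    ⟨t, hG.top_mem, fun h => z.bot_notMem (z.isTheory.up h H.bot_top)⟩
    (fun ⟨B, hB, h⟩ h' => ⟨B, hB, fun hz => h (z.isTheory.up hz (DFNL.prod_mono h' (.id B)))⟩)
    (by
      rintro A A' ⟨B, hB, h⟩ ⟨B', hB', h'⟩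
      refine ⟨B.and B', hG.and_mem hB hB', fun hz => ?_⟩
      rcases z.prime (z.isTheory.up hz (DFNL.or_prod_le (DFNL.orR₁ _ _ _ (.id _))
        (DFNL.orR₂ _ _ _ (.id _)))) with hz | hz
      · exact h (z.isTheory.up hz (DFNL.prod_mono (.id A) (DFNL.and_left _ _)))
      · exact h' (z.isTheory.up hz (DFNL.prod_mono (.id A') (DFNL.and_right _ _))))
    (fun A hA ⟨B, hB, hz⟩ => hz (h A hA B hB))
  exact ⟨x, hSx, fun A hA B hB => by_contra fun hz => hx A ⟨B, hB, hz⟩ hA⟩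

lemma exists_right {S G : Set (DFml P)} (hS : IsTheory Ψ t S) (hG : IsTheory Ψ t G)
    (z : PrimeTheory Ψ b t) (h : ∀ A ∈ S, ∀ B ∈ G, A.prod B ∈ z.carrier) :
    ∃ y : PrimeTheory Ψ b t, G ⊆ y.carrier ∧ ∀ A ∈ S, ∀ B ∈ y.carrier, A.prod B ∈ z.carrier := by
  obtain ⟨y, hGy, hy⟩ := hG.exists_prime (b := b) (I := {B | ∃ A ∈ S, A.prod B ∉ z.carrier})
    ⟨t, hS.top_mem, fun h => z.bot_notMem (z.isTheory.up h H.top_bot)⟩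
    (fun ⟨A, hA, h⟩ h' => ⟨A, hA, fun hz => h (z.isTheory.up hz (DFNL.prod_mono (.id A) h'))⟩)
    (by
      rintro B B' ⟨A, hA, h⟩ ⟨A', hA', h'⟩
      refine ⟨A.and A', hS.and_mem hA hA', fun hz => ?_⟩
      rcases z.prime (z.isTheory.up hz (DFNL.prod_or_le (DFNL.orR₁ _ _ _ (.id _))
        (DFNL.orR₂ _ _ _ (.id _)))) with hz | hz
      · exact h (z.isTheory.up hz (DFNL.prod_mono (DFNL.and_left _ _) (.id B)))
      · exact h' (z.isTheory.up hz (DFNL.prod_mono (DFNL.and_right _ _) (.id B'))))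
    (fun B hB ⟨A, hA, hz⟩ => hz (h A hA B hB))
  exact ⟨y, hGy, fun A hA B hB => by_contra fun hz => hy B ⟨A, hA, hz⟩ hB⟩

/-- The canonical frame of prime theories. -/
def frame : UnitalFrame (PrimeTheory Ψ b t) where
  R x y z := ∀ A ∈ x.carrier, ∀ B ∈ y.carrier, A.prod B ∈ z.carrier
  E := {e | ∀ A, DFNL Ψ none A → A ∈ e.carrier}
  R_mono h hx hy hz A hA B hB := hz (h A (hx hA) B (hy hB))
  E_upper _ _ h he A hA := h (he A hA)
  le_of_left {_ _ z} he h A hA :=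
    z.isTheory.up (h (A.over A) (he _ (.overR none A A (.id A))) A hA) (DFNL.over_prod_le A A)
  le_of_right {_ _ z} he h A hA :=
    z.isTheory.up (h A hA (A.under A) (he _ (.underR none A A (.id A)))) (DFNL.prod_under_le A A)
  exists_left x := exists_left H (isTheory_theorems H.top) x.isTheory x fun _ hA _ hB =>
    x.isTheory.up hB (DFNL.le_of_theorem_prod hA (.id _))
  exists_right x := exists_right H x.isTheory (isTheory_theorems H.top) x fun _ hA _ hB =>
    x.isTheory.up hA (DFNL.le_of_prod_theorem hB (.id _))

/-- The bounds by `t` make the principal theories of `A` and `B` legitimate; these are enlarged to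
prime theories one factor at a time. -/
lemma prod_mem_iff {A B : DFml P} (hA : DFNL Ψ (Ant.fml A) t) (hB : DFNL Ψ (Ant.fml B) t)
    (z : PrimeTheory Ψ b t) : A.prod B ∈ z.carrier ↔
      ∃ x : PrimeTheory Ψ b t, A ∈ x.carrier ∧ ∃ y : PrimeTheory Ψ b t, B ∈ y.carrier ∧
        (frame H).R x y z := by
  constructor
  · intro h
    obtain ⟨x, hAx, hx⟩ := exists_left H (isTheory_principal hA) (isTheory_principal hB) z
      fun _ hA' _ hB' => z.isTheory.up h (DFNL.prod_mono hA' hB')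
    obtain ⟨y, hBy, hy⟩ := exists_right H x.isTheory (isTheory_principal hB) z hx
    exact ⟨x, hAx (.id A), y, hBy (.id B), hy⟩
  · rintro ⟨x, hx, y, hy, h⟩
    exact h A hx B hy

/-- If `A.under B` is not in `y`, the formulas `C` with `A.under C` in `y` form a theory omitting
`B`. Because `b` lies below `B`, it extends to a prime `z` still omitting `B`, and the principal
theory of `A` then extends to a point `x` related to `y` and `z`. -/
lemma under_mem_iff {A B : DFml P} (hA : DFNL Ψ (Ant.fml A) t) (hB : DFNL Ψ (Ant.fml b) B)
    (y : PrimeTheory Ψ b t) : A.under B ∈ y.carrier ↔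
      ∀ x : PrimeTheory Ψ b t, A ∈ x.carrier → ∀ z, (frame H).R x y z → B ∈ z.carrier := by
  constructor
  · intro h x hx z hR
    exact z.isTheory.up (hR A hx _ h) (DFNL.prod_under_le A B)
  · intro h
    by_contra hy
    have hS : IsTheory Ψ t {C | A.under C ∈ y.carrier} :=
      { top_mem := y.isTheory.up y.isTheory.top_mem
          (DFNL.le_under ((DFNL.prod_mono hA (.id t)).trans H.top_top))
        up := fun h h' => y.isTheory.up h (DFNL.le_under ((DFNL.prod_under_le _ _).trans h'))
        and_mem := fun h h' => y.isTheory.up (y.isTheory.and_mem h h')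
          (DFNL.le_under (.andR _ _ _
            ((DFNL.prod_mono (.id A) (DFNL.and_left _ _)).trans (DFNL.prod_under_le _ _))
            ((DFNL.prod_mono (.id A) (DFNL.and_right _ _)).trans (DFNL.prod_under_le _ _)))) }
    obtain ⟨z, hz, hBz⟩ := hS.exists_omitting hB hy
    -- For `D` in `y`, `D` lies below `A.under (A.prod D)`, which puts `A.prod D` in `z`.
    obtain ⟨x, hAx, hx⟩ := exists_left H (isTheory_principal hA) y.isTheory z
      fun _ hA' D hD => z.isTheory.up (hz (y.isTheory.up hD (DFNL.le_under (.id _))))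
        (DFNL.prod_mono hA' (.id D))
    exact hBz (h x (hAx (.id A)) z hx)

lemma over_mem_iff {A B : DFml P} (hB : DFNL Ψ (Ant.fml B) t) (hA : DFNL Ψ (Ant.fml b) A)
    (x : PrimeTheory Ψ b t) : A.over B ∈ x.carrier ↔
      ∀ y : PrimeTheory Ψ b t, B ∈ y.carrier → ∀ z, (frame H).R x y z → A ∈ z.carrier := by
  constructor
  · intro h y hy z hR
    exact z.isTheory.up (hR _ h B hy) (DFNL.over_prod_le A B)
  · intro h
    by_contra hx
    have hS : IsTheory Ψ t {C | C.over B ∈ x.carrier} :=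
      { top_mem := x.isTheory.up x.isTheory.top_mem
          (DFNL.le_over ((DFNL.prod_mono (.id t) hB).trans H.top_top))
        up := fun h h' => x.isTheory.up h (DFNL.le_over ((DFNL.over_prod_le _ _).trans h'))
        and_mem := fun h h' => x.isTheory.up (x.isTheory.and_mem h h')
          (DFNL.le_over (.andR _ _ _
            ((DFNL.prod_mono (DFNL.and_left _ _) (.id B)).trans (DFNL.over_prod_le _ _))
            ((DFNL.prod_mono (DFNL.and_right _ _) (.id B)).trans (DFNL.over_prod_le _ _)))) }
    obtain ⟨z, hz, hAz⟩ := hS.exists_omitting hA hx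
    obtain ⟨y, hBy, hy⟩ := exists_right H x.isTheory (isTheory_principal hB) z
      fun D hD _ hB' => z.isTheory.up (hz (x.isTheory.up hD (DFNL.le_over (.id _))))
        (DFNL.prod_mono (.id D) hB')
    exact hAz (h y (hBy (.id B)) z hy)

end PrimeTheory

/-! ### The truth lemma -/

lemma BFml.self_mem_sub (A : BFml P) : A ∈ A.sub := by
  cases A <;> simp [BFml.sub]

/-- The canonical valuation. -/
def canonicalVal (Ψ : Set (Sequent (DFml P))) (b t : DFml P) (p : P) : Set (PrimeTheory Ψ b t) :=
  {x | DFml.atom p ∈ x.carrier}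

lemma canonicalVal_upper (p : P) : IsUpperSet (canonicalVal Ψ b t p) := fun _ _ h hx => h hx

section Truth

variable {pb pt : P} (H : BoundPair Ψ (.atom pb) (.atom pt))

/-- The constants are settled by the choice of points and the lattice connectives by primeness and
closure. Only the product and the residuals use the bounds, upper ones to generate theories and
lower ones to omit a formula. -/
lemma mem_sem_iff (A : BFml P)
    (hA : ∀ B ∈ A.sub, DFNL Ψ (Ant.fml (.atom pb)) (B.sec pb pt) ∧
      DFNL Ψ (Ant.fml (B.sec pb pt)) (.atom pt)) (z : PrimeTheory Ψ (.atom pb) (.atom pt)) :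
    z ∈ (PrimeTheory.frame H).sem (canonicalVal Ψ _ _) A ↔ A.sec pb pt ∈ z.carrier := by
  induction A generalizing z with
  | atom p => rfl
  | bot => exact ⟨fun h => h.elim, fun h => z.bot_notMem h⟩
  | top => exact ⟨fun _ => z.isTheory.top_mem, fun _ => trivial⟩
  | and A B ihA ihB =>
    refine (and_congr (ihA (fun C hC => hA C (.inl (.inr hC))) z)
      (ihB (fun C hC => hA C (.inr hC)) z)).trans ⟨fun h => z.isTheory.and_mem h.1 h.2, fun h =>
        ⟨z.isTheory.up h (DFNL.and_left _ _), z.isTheory.up h (DFNL.and_right _ _)⟩⟩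
  | or A B ihA ihB =>
    refine (or_congr (ihA (fun C hC => hA C (.inl (.inr hC))) z)
      (ihB (fun C hC => hA C (.inr hC)) z)).trans ⟨fun h => h.elim
        (fun h => z.isTheory.up h (.orR₁ _ _ _ (.id _)))
        (fun h => z.isTheory.up h (.orR₂ _ _ _ (.id _))), z.prime⟩
  | prod A B ihA ihB =>
    have iA := ihA (fun C hC => hA C (.inl (.inr hC)))
    have iB := ihB (fun C hC => hA C (.inr hC))
    have bA := hA A (.inl (.inr A.self_mem_sub))
    have bB := hA B (.inr B.self_mem_sub)
    simp only [BFml.sec, PrimeTheory.prod_mem_iff H bA.2 bB.2, UnitalFrame.sem, UnitalFrame.mul,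
      Set.mem_ofPred_eq, iA, iB]
  | under A B ihA ihB =>
    have iA := ihA (fun C hC => hA C (.inl (.inr hC)))
    have iB := ihB (fun C hC => hA C (.inr hC))
    have bA := hA A (.inl (.inr A.self_mem_sub))
    have bB := hA B (.inr B.self_mem_sub)
    simp only [BFml.sec, PrimeTheory.under_mem_iff H bA.2 bB.1, UnitalFrame.sem,
      Set.mem_ofPred_eq, iA, iB]
  | _ A B ihA ihB =>
    have iA := ihA (fun C hC => hA C (.inl (.inr hC)))
    have iB := ihB (fun C hC => hA C (.inr hC))
    have bA := hA A (.inl (.inr A.self_mem_sub))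
    have bB := hA B (.inr B.self_mem_sub)
    simp only [BFml.sec, PrimeTheory.over_mem_iff H bB.2 bA.1, UnitalFrame.sem,
      Set.mem_ofPred_eq, iA, iB]

/-! ### Reduction of formula trees to product formulas -/

/-- The formula corresponding to a formula tree. -/
def FTree.toFml : FTree (DFml P) → DFml P
  | .leaf A => A
  | .node X Y => .prod X.toFml Y.toFml

lemma DFNL.le_toFml (X : FTree (DFml P)) : DFNL Ψ (some X) X.toFml := by
  induction X with
  | leaf A => exact .id A
  | node X Y hX hY => exact .prodR (some X) (some Y) _ _ hX hY

/-- Composition of contexts. -/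
def FCtx.comp {F : Type*} : FCtx F → FCtx F → FCtx F
  | .hole, D => D
  | .left C Y, D => .left (C.comp D) Y
  | .right X C, D => .right X (C.comp D)

lemma FCtx.fill_comp {F : Type*} (C D : FCtx F) (Δ : Ant F) :
    (C.comp D).fill Δ = C.fill (D.fill Δ) := by
  induction C with
  | hole => rfl
  | left C Y ih => simp only [FCtx.comp, FCtx.fill, ih]
  | right X C ih => simp only [FCtx.comp, FCtx.fill, ih]

/-- The arbitrary context is needed for the induction: each subtree is contracted inside the context
formed by its sibling. -/
lemma DFNL.fill_toFml (X : FTree (DFml P)) (C : FCtx (DFml P)) {A : DFml P}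
    (h : DFNL Ψ (C.fill (some X)) A) : DFNL Ψ (C.fill (Ant.fml X.toFml)) A := by
  induction X generalizing C with
  | leaf B => exact h
  | node X Y hX hY =>
    refine .prodL C _ _ _ ?_
    have h₁ := hX (C.comp (.left .hole Y)) (by rw [FCtx.fill_comp]; exact h)
    rw [FCtx.fill_comp] at h₁
    have h₂ := hY (C.comp (.right (.leaf X.toFml) .hole)) (by rw [FCtx.fill_comp]; exact h₁)
    rw [FCtx.fill_comp] at h₂
    exact h₂

lemma toFml_le_top (htt : DFNL Ψ (Ant.fml (t.prod t)) t) (X : FTree (DFml P))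
    (hX : ∀ A ∈ X.fmls, DFNL Ψ (Ant.fml A) t) : DFNL Ψ (Ant.fml X.toFml) t := by
  induction X with
  | leaf A => exact hX A rfl
  | node X Y ihX ihY =>
    exact (DFNL.prod_mono (ihX fun A hA => hX A (.inl hA))
      (ihY fun A hA => hX A (.inr hA))).trans htt

lemma FTree.fmls_map {F G : Type*} (f : F → G) (X : FTree F) : (X.map f).fmls = f '' X.fmls := by
  induction X with
  | leaf A => simp [FTree.map, FTree.fmls]
  | node X Y hX hY => simp [FTree.map, FTree.fmls, hX, hY, Set.image_union]

lemma mem_treeSem_iff (X : FTree (BFml P))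
    (hX : ∀ A ∈ X.fmls, ∀ B ∈ A.sub, DFNL Ψ (Ant.fml (.atom pb)) (B.sec pb pt) ∧
      DFNL Ψ (Ant.fml (B.sec pb pt)) (.atom pt)) (z : PrimeTheory Ψ (.atom pb) (.atom pt)) :
    z ∈ (PrimeTheory.frame H).treeSem (canonicalVal Ψ _ _) X ↔
      (X.map (BFml.sec pb pt)).toFml ∈ z.carrier := by
  induction X generalizing z with
  | leaf A => exact mem_sem_iff H A (hX A rfl) z
  | node X Y ihX ihY =>
    have le : ∀ Z : FTree (BFml P), Z.fmls ⊆ (FTree.node X Y).fmls →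
        DFNL Ψ (Ant.fml (Z.map (BFml.sec pb pt)).toFml) (.atom pt) := by
      intro Z hZ
      refine toFml_le_top H.top_top _ ?_
      rw [FTree.fmls_map]
      rintro _ ⟨A, hA, rfl⟩
      exact (hX A (hZ hA) A A.self_mem_sub).2
    simp only [FTree.map, FTree.toFml, UnitalFrame.treeSem, UnitalFrame.mul, Set.mem_ofPred_eq,
      PrimeTheory.prod_mem_iff H (le X Set.subset_union_left) (le Y Set.subset_union_right),
      ihX (fun A hA => hX A (.inl hA)), ihY (fun A hA => hX A (.inr hA))]

/-- If all relevant formulas are bounded by `pb` and `pt`, the translation of a sequent derivable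
in BDFNL* is derivable in DFNL*. -/
theorem DFNL.of_BDFNL {Φ : Set (Sequent (BFml P))} {s : Sequent (BFml P)}
    (H : BoundPair Ψ (.atom pb) (.atom pt))
    (hΦ : ∀ r ∈ Φ, DFNL Ψ (r.map (BFml.sec pb pt)).ant (r.map (BFml.sec pb pt)).suc)
    (hT : ∀ r, r = s ∨ r ∈ Φ → ∀ A ∈ r.fmls, ∀ B ∈ A.sub,
      DFNL Ψ (Ant.fml (.atom pb)) (B.sec pb pt) ∧ DFNL Ψ (Ant.fml (B.sec pb pt)) (.atom pt))
    (h : BDFNL Φ s.ant s.suc) :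
    DFNL Ψ (s.map (BFml.sec pb pt)).ant (s.map (BFml.sec pb pt)).suc := by
  have hs := UnitalFrame.soundness (F := PrimeTheory.frame H) canonicalVal_upper (Φ := Φ) (by
    rintro ⟨X, A⟩ hr z hz
    refine (mem_sem_iff H A (hT _ (.inr hr) A (.inr rfl)) z).2 ?_
    cases X with
    -- With an empty antecedent `z` is a unit point, so it contains every theorem.
    | none => exact hz _ (hΦ _ hr)
    | some X =>
      exact z.isTheory.up ((mem_treeSem_iff H X
        (fun B hB => hT _ (.inr hr) B (.inl ⟨X, rfl, hB⟩)) z).1 hz)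
        (DFNL.fill_toFml _ .hole (hΦ _ hr))) h
  by_contra hn
  obtain ⟨X, A⟩ := s
  have hA := hT _ (.inl rfl) A (.inr rfl)
  -- By soundness and the truth lemma, such a point contradicts derivability in BDFNL*.
  suffices ∃ z ∈ (PrimeTheory.frame H).antSem (canonicalVal Ψ _ _) X,
      A.sec pb pt ∉ z.carrier by
    obtain ⟨z, hz, hzA⟩ := this
    exact hzA ((mem_sem_iff H A hA z).1 (hs hz))
  have hbA := (hA A A.self_mem_sub).1
  cases X with
  | none =>
    -- A prime theory extending the set of theorems is a unit point; the assumed sequent with empty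
    -- antecedent makes that set a theory.
    obtain ⟨z, hz, hzA⟩ := (isTheory_theorems H.top).exists_omitting hbA hn
    exact ⟨z, fun B hB => hz hB, hzA⟩
  | some X =>
    have hX := fun B hB => hT _ (.inl rfl) B (.inl ⟨X, rfl, hB⟩)
    have hXt : DFNL Ψ (Ant.fml (X.map (BFml.sec pb pt)).toFml) (.atom pt) := by
      refine toFml_le_top H.top_top _ ?_
      rw [FTree.fmls_map]
      rintro _ ⟨B, hB, rfl⟩
      exact (hX B hB B B.self_mem_sub).2
    obtain ⟨z, hz, hzA⟩ := (isTheory_principal hXt).exists_omitting hbA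
      (fun h => hn ((DFNL.le_toFml _).trans h))
    exact ⟨z, (mem_treeSem_iff H X hX z).2 (hz (.id _)), hzA⟩

end Truth

end Canonical

/-! ### The inverse translation -/

section Inverse

variable {P : Type*}

open Classical in
/-- Replace the letters `pb` and `pt` by `⊥` and `⊤`. -/
noncomputable def DFml.unsec (pb pt : P) : DFml P → BFml P
  | .atom p => if p = pb then .bot else if p = pt then .top else .atom p
  | .and A B => .and (A.unsec pb pt) (B.unsec pb pt)
  | .or A B => .or (A.unsec pb pt) (B.unsec pb pt)
  | .prod A B => .prod (A.unsec pb pt) (B.unsec pb pt)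
  | .under A B => .under (A.unsec pb pt) (B.unsec pb pt)
  | .over A B => .over (A.unsec pb pt) (B.unsec pb pt)

lemma DFml.unsec_bot (pb pt : P) : (DFml.atom pb).unsec pb pt = .bot := by
  simp [DFml.unsec]

lemma DFml.unsec_top {pb pt : P} (hne : pb ≠ pt) : (DFml.atom pt).unsec pb pt = .top := by
  simp [DFml.unsec, hne.symm]

lemma BFml.unsec_sec {pb pt : P} (hne : pb ≠ pt) (A : BFml P) (hb : .atom pb ∉ A.sub)
    (ht : .atom pt ∉ A.sub) : (A.sec pb pt).unsec pb pt = A := by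
  induction A with
  | atom p =>
    have h₁ : p ≠ pb := by rintro rfl; exact hb rfl
    have h₂ : p ≠ pt := by rintro rfl; exact ht rfl
    simp [BFml.sec, DFml.unsec, h₁, h₂]
  | bot => exact DFml.unsec_bot pb pt
  | top => exact DFml.unsec_top hne
  | _ A B hA hB =>
    simp only [BFml.sub, Set.mem_union, not_or] at hb ht
    simp only [BFml.sec, DFml.unsec, hA hb.1.2 ht.1.2, hB hb.2 ht.2]

/-- Apply a map to every formula of a context. -/
def FCtx.map {F G : Type*} (f : F → G) : FCtx F → FCtx G
  | .hole => .hole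
  | .left C Y => .left (C.map f) (Y.map f)
  | .right X C => .right (X.map f) (C.map f)

/-- Apply a map to every formula of an antecedent. -/
def Ant.map {F G : Type*} (f : F → G) : Ant F → Ant G := Option.map (FTree.map f)

lemma Ant.map_comp {F G : Type*} (f : F → G) (Γ Δ : Ant F) :
    (Γ.comp Δ).map f = (Γ.map f).comp (Δ.map f) := by
  cases Γ <;> cases Δ <;> rfl

lemma Ant.map_fml {F G : Type*} (f : F → G) (A : F) : (Ant.fml A).map f = Ant.fml (f A) := rfl

lemma Ant.map_fill {F G : Type*} (f : F → G) (C : FCtx F) (Δ : Ant F) :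
    (C.fill Δ).map f = (C.map f).fill (Δ.map f) := by
  induction C with
  | hole => rfl
  | left C Y ih => simp only [FCtx.fill, FCtx.map, Ant.map_comp, ih]; rfl
  | right X C ih => simp only [FCtx.fill, FCtx.map, Ant.map_comp, ih]; rfl

/-- The inverse translation preserves derivability. -/
theorem BDFNL.of_DFNL {pb pt : P} {Φ : Set (Sequent (BFml P))} {Ψ : Set (Sequent (DFml P))}
    (hΨ : ∀ s ∈ Ψ, BDFNL Φ (s.ant.map (DFml.unsec pb pt)) (s.suc.unsec pb pt))
    {Γ : Ant (DFml P)} {A : DFml P} (h : DFNL Ψ Γ A) :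
    BDFNL Φ (Γ.map (DFml.unsec pb pt)) (A.unsec pb pt) := by
  induction h with
  | assume s hs => exact hΨ s hs
  | id A => exact .id _
  | distr A B C => exact .distr _ _ _
  | underL Γ Δ A B C _ _ ih₁ ih₂ =>
    simp only [Ant.map_fill, Ant.map_comp, Ant.map_fml] at *
    exact .underL _ _ _ _ _ ih₁ ih₂
  | underR Γ A B _ ih =>
    simp only [Ant.map_comp, Ant.map_fml] at *
    exact .underR _ _ _ ih
  | overL Γ Δ A B C _ _ ih₁ ih₂ =>
    simp only [Ant.map_fill, Ant.map_comp, Ant.map_fml] at *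
    exact .overL _ _ _ _ _ ih₁ ih₂
  | overR Γ A B _ ih =>
    simp only [Ant.map_comp, Ant.map_fml] at *
    exact .overR _ _ _ ih
  | prodL Γ A B C _ ih =>
    simp only [Ant.map_fill, Ant.map_comp, Ant.map_fml] at *
    exact .prodL _ _ _ _ ih
  | prodR Γ Δ A B _ _ ih₁ ih₂ =>
    rw [Ant.map_comp]
    exact .prodR _ _ _ _ ih₁ ih₂
  | cut Γ Δ A B _ _ ih₁ ih₂ =>
    simp only [Ant.map_fill, Ant.map_fml] at *
    exact .cut _ _ _ _ ih₁ ih₂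
  | andL₁ Γ A₁ A₂ B _ ih =>
    simp only [Ant.map_fill, Ant.map_fml] at *
    exact .andL₁ _ _ _ _ ih
  | andL₂ Γ A₁ A₂ B _ ih =>
    simp only [Ant.map_fill, Ant.map_fml] at *
    exact .andL₂ _ _ _ _ ih
  | andR Γ A B _ _ ih₁ ih₂ => exact .andR _ _ _ ih₁ ih₂
  | orL Γ A₁ A₂ B _ _ ih₁ ih₂ =>
    simp only [Ant.map_fill, Ant.map_fml] at *
    exact .orL _ _ _ _ ih₁ ih₂
  | orR₁ Γ A₁ A₂ _ ih => exact .orR₁ _ _ _ ih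
  | orR₂ Γ A₁ A₂ _ ih => exact .orR₂ _ _ _ ih

lemma FTree.map_map_eq_self {F G : Type*} (f : F → G) (g : G → F) (X : FTree F)
    (h : ∀ A ∈ X.fmls, g (f A) = A) : (X.map f).map g = X := by
  induction X with
  | leaf A => exact congrArg FTree.leaf (h A rfl)
  | node X Y hX hY =>
    simp only [FTree.map, hX fun A hA => h A (.inl hA), hY fun A hA => h A (.inr hA)]

lemma Sequent.map_map_eq_self {F G : Type*} (f : F → G) (g : G → F) (s : Sequent F)
    (h : ∀ A ∈ s.fmls, g (f A) = A) : (s.map f).map g = s := by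
  obtain ⟨_ | X, A⟩ := s
  · exact congrArg (Sequent.mk none) (h A (.inr rfl))
  · simp only [Sequent.map, Option.map_some, h A (.inr rfl),
      X.map_map_eq_self f g fun B hB => h B (.inl ⟨X, rfl, hB⟩)]

/-- The inverse translation of `Theta` is derivable. -/
lemma BDFNL.unsec_theta {pb pt : P} (hne : pb ≠ pt) (Φ : Set (Sequent (BFml P)))
    (T : Set (DFml P)) {s : Sequent (DFml P)} (hs : s ∈ Theta pb pt T) :
    BDFNL Φ (s.ant.map (DFml.unsec pb pt)) (s.suc.unsec pb pt) := by
  rcases hs with ⟨A, -, rfl | rfl | rfl | rfl | rfl | rfl⟩ | rfl <;>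
    simp only [Ant.map_comp, Ant.map_fml, DFml.unsec_bot, DFml.unsec_top hne]
  · exact .botL .hole _
  · exact .botL (.right (.leaf _) .hole) _
  · exact .botL (.left .hole (.leaf _)) _
  all_goals exact .topR _

end Inverse

/-! ### Finiteness -/

section Finite

variable {P : Type*}

lemma BFml.finite_sub (A : BFml P) : A.sub.Finite := by
  induction A with
  | atom p => exact Set.finite_singleton _
  | bot => exact Set.finite_singleton _
  | top => exact Set.finite_singleton _
  | _ A B hA hB => exact ((Set.finite_singleton _).union hA).union hB

lemma FTree.finite_fmls {F : Type*} (X : FTree F) : X.fmls.Finite := by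
  induction X with
  | leaf A => exact Set.finite_singleton _
  | node X Y hX hY => exact hX.union hY

lemma Sequent.finite_fmls {F : Type*} (s : Sequent F) : s.fmls.Finite := by
  obtain ⟨_ | X, A⟩ := s
  · exact (Set.finite_singleton A).subset fun B hB => by simpa [Sequent.fmls] using hB
  · exact (X.finite_fmls.union (Set.finite_singleton A)).subset fun B hB => by
      simpa [Sequent.fmls, or_comm] using hB

lemma finite_subT {Φ : Set (Sequent (BFml P))} (hΦ : Φ.Finite) (s : Sequent (BFml P)) :
    (subT Φ s).Finite := by
  refine Set.Finite.union ?_ (Set.toFinite _)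
  refine ((hΦ.insert s).biUnion fun t _ => t.finite_fmls.biUnion fun A _ =>
    A.finite_sub).subset ?_
  rintro B ⟨t, ht, A, hA, hB⟩
  exact Set.mem_biUnion (x := t) ht (Set.mem_biUnion hA hB)

lemma finite_theta (pb pt : P) {T : Set (DFml P)} (hT : T.Finite) : (Theta pb pt T).Finite := by
  refine Set.Finite.union ?_ (Set.finite_singleton _)
  refine (hT.biUnion fun A _ => Set.toFinite
    ({⟨Ant.fml (.atom pb), A⟩,
      ⟨Ant.comp (Ant.fml A) (Ant.fml (.atom pb)), .atom pb⟩,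
      ⟨Ant.comp (Ant.fml (.atom pb)) (Ant.fml A), .atom pb⟩,
      ⟨Ant.fml A, .atom pt⟩,
      ⟨Ant.comp (Ant.fml A) (Ant.fml (.atom pt)), .atom pt⟩,
      ⟨Ant.comp (Ant.fml (.atom pt)) (Ant.fml A), .atom pt⟩} : Set (Sequent (DFml P)))).subset ?_
  rintro s ⟨A, hA, hs⟩
  exact Set.mem_biUnion hA hs

end Finite

/-! ### The main theorem -/

/-- The assumptions `Theta` make `pb` and `pt` behave like bounds. -/
lemma boundPair_of_theta {P : Type*} {pb pt : P} {Ψ : Set (Sequent (DFml P))} {T : Set (DFml P)}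
    (hT : .atom pt ∈ T) (h : Theta pb pt T ⊆ Ψ) : BoundPair Ψ (.atom pb) (.atom pt) where
  -- The instances of `Theta` used for the three products are those at the letter `pt` itself, hence
  -- the need for `⊤` in `T`.
  bot_top := DFNL.prod_le (.assume ⟨_, _⟩ (h (.inl ⟨_, hT, .inr (.inr (.inl rfl))⟩)))
  top_bot := DFNL.prod_le (.assume ⟨_, _⟩ (h (.inl ⟨_, hT, .inr (.inl rfl)⟩)))
  top_top := DFNL.prod_le
    (.assume ⟨_, _⟩ (h (.inl ⟨_, hT, .inr (.inr (.inr (.inr (.inl rfl))))⟩)))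
  top := .assume ⟨_, _⟩ (h (.inr rfl))

theorem mainTheorem4 {P : Type*} (pb pt : P) (hne : pb ≠ pt)
    (Φ : Set (Sequent (BFml P))) (hΦ : Φ.Finite) (s : Sequent (BFml P))
    (hpb : BFml.atom pb ∉ subT Φ s) (hpt : BFml.atom pt ∉ subT Φ s) :
    (Theta pb pt (ec pb pt (subT Φ s))).Finite ∧
    (BDFNL Φ s.ant s.suc ↔
      DFNL (Sequent.map (BFml.sec pb pt) '' Φ ∪ Theta pb pt (ec pb pt (subT Φ s)))
        (s.map (BFml.sec pb pt)).ant (s.map (BFml.sec pb pt)).suc) := by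
  refine ⟨finite_theta pb pt ((finite_subT hΦ s).image _), fun h => ?_, fun h => ?_⟩
  · refine DFNL.of_BDFNL (boundPair_of_theta (T := ec pb pt (subT Φ s))
      ⟨.top, .inr (.inr rfl), rfl⟩ Set.subset_union_right)
      (fun r hr => .assume _ (.inl ⟨r, hr, rfl⟩)) (fun r hr A hA B hB => ?_) h
    have hB' : B.sec pb pt ∈ ec pb pt (subT Φ s) := ⟨B, .inl ⟨r, hr, A, hA, hB⟩, rfl⟩
    exact ⟨.assume ⟨_, _⟩ (.inr (.inl ⟨_, hB', .inl rfl⟩)),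
      .assume ⟨_, _⟩ (.inr (.inl ⟨_, hB', .inr (.inr (.inr (.inl rfl)))⟩))⟩
  -- Freshness rules out occurrences of the letters in these sequents, so no original letter is
  -- turned into a constant on the way back.
  · have key : ∀ r, r = s ∨ r ∈ Φ → (r.map (BFml.sec pb pt)).map (DFml.unsec pb pt) = r :=
      fun r hr => r.map_map_eq_self _ _ fun A hA => A.unsec_sec hne
        (fun hA' => hpb (.inl ⟨r, hr, A, hA, hA'⟩)) (fun hA' => hpt (.inl ⟨r, hr, A, hA, hA'⟩))
    have h' := BDFNL.of_DFNL (pb := pb) (pt := pt) (Φ := Φ) ?_ h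
    · change BDFNL Φ ((s.map (BFml.sec pb pt)).map (DFml.unsec pb pt)).ant
        ((s.map (BFml.sec pb pt)).map (DFml.unsec pb pt)).suc at h'
      rwa [key s (.inl rfl)] at h'
    · rintro _ (⟨r, hr, rfl⟩ | hr)
      · change BDFNL Φ ((r.map (BFml.sec pb pt)).map (DFml.unsec pb pt)).ant
          ((r.map (BFml.sec pb pt)).map (DFml.unsec pb pt)).suc
        rw [key r (.inr hr)]
        exact .assume r hr
      · exact .unsec_theta hne Φ _ hr
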